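/- A \emph{well-labelled path} of size $n\ge 1$ is a pair $(\mathbf p,\sigma)$ made of a word $\mathbf p=p_1p_2\cdots p_{n-1}$ on the alphabet $\{-1,0,+1\}$ and a permutation $\sigma=\sigma_1\sigma_2\cdots\sigma_n$ of $\{1,\dots,n\}$ such that, for all $1\le i\le n-1$, $p_i=-1$ implies $\sigma_i<\sigma_{i+1}$ and $p_i=+1$ implies $\sigma_i>\sigma_{i+1}$. It is \emph{Motzkin} if $\sum_{i=1}^{j}p_i\ge 0$ for all $1\le j\le n-2$ and $\sum_{i=1}^{n-1}p_i=-1$. Its \emph{horizontal steps} are the letters $0$ of $\mathbf p$. Then for all integers $n\ge 1$ and $k\ge 0$, the number $a_{n,k}$ of well-labelled Motzkin paths of size $n$ having exactly $k$ horizontal steps is $$a_{n,k}=\binom{n}{k}\binom{n-2}{k}\,k!\,(n-k-1)!!\,(n-k-3)!!$$ if $n-k$ is even, and $a_{n,k}=0$ otherwise. Here $m!!=m(m-2)(m-4)\cdots$ is the product of the positive integers at most $m$ with the parity of $m$, $(-1)!!=1$, and the right-hand side is read as $0$ when $k>n-2$. -/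

import Mathlib

/-- A well-labelled path of size `n`: a word `p₁ … pₙ₋₁` on the alphabet `{-1, 0, 1}` together with
a permutation `σ` of an `n`-element chain (here `Fin n`, so all indices and labels are shifted
by one), such that `pᵢ = -1` implies `σᵢ < σᵢ₊₁` and `pᵢ = 1` implies `σᵢ > σᵢ₊₁`. -/
@[ext]
structure WellLabelledPath (n : ℕ) where
  /-- the letters of the word -/
  step : Fin (n - 1) → SignType
  /-- the permutation labelling the lattice points of the path -/
  label : Equiv.Perm (Fin n)
  lt_of_step_eq_neg_one : ∀ i : Fin (n - 1), step i = -1 →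
    label ⟨i.val, by omega⟩ < label ⟨i.val + 1, by omega⟩
  gt_of_step_eq_one : ∀ i : Fin (n - 1), step i = 1 →
    label ⟨i.val, by omega⟩ > label ⟨i.val + 1, by omega⟩

namespace WellLabelledPath

/-- The partial sum `p₁ + ⋯ + pⱼ` of the letters (the height of the path after `j` steps). -/
def height {n : ℕ} (P : WellLabelledPath n) (j : ℕ) : ℤ :=
  ∑ i : Fin (n - 1) with i.val < j, (P.step i : ℤ)

/-- `p₁ + ⋯ + pⱼ ≥ 0` for `j = 1, …, n - 2`, and `p₁ + ⋯ + pₙ₋₁ = -1`. -/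
def IsMotzkin {n : ℕ} (P : WellLabelledPath n) : Prop :=
  (∀ j : ℕ, 1 ≤ j → j + 2 ≤ n → 0 ≤ P.height j) ∧ P.height (n - 1) = -1

/-- The number of horizontal steps: the number of letters `0` in the word. -/
def horizontalSteps {n : ℕ} (P : WellLabelledPath n) : ℕ :=
  Finset.card {i : Fin (n - 1) | P.step i = 0}

/-- There are finitely many well-labelled paths of a given size. -/
instance instFinite (n : ℕ) : Finite (WellLabelledPath n) :=
  Finite.of_injective (fun P : WellLabelledPath n => (P.step, P.label)) (by
    intro P Q h
    simp only [Prod.mk.injEq] at h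
    exact WellLabelledPath.ext h.1 h.2)

end WellLabelledPath

/-- The double factorial of an integer `m`: the product `m (m - 2) (m - 4) ⋯` of its positive
factors. The product is empty, hence `1`, for `m ≤ 0`; in particular `(-1)!! = 1`. -/
def intDoubleFactorial (m : ℤ) : ℕ := Nat.doubleFactorial m.toNat

/-! Give a word `w` with `N` letters the weight (probability that a uniform permutation of size `N +
1` is compatible with `w`) times `X` to the number of letters `0`. A letter `0` imposes nothing, so
the labels on its two sides are independent: `W(u 0 v) = X W(u) W(v)`. Exactly one of the two strict
orders holds there, so `W(u 1 v) + W(u (-1) v) = W(u) W(v)` (`wordWeight_add`). Reversing a path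
preserves weights (`wordWeight_revNeg`).

A Motzkin word of size `m + 2` is an excursion of length `m` followed by `-1`; let `c m` be the
total weight of these words. Cutting at the first return to the ground, and pairing each word with
one whose returning step is flipped, gives the quadratic recurrence `QuadRec`. With `x` marking the
letters `0`, it says that `R = 1 - x t - t² ∑ c m t^m` satisfies `R² = (1 - x t)² - t²`.

Hence `∂ₓ R = t (t ∂ₜ R - R)`, that is, `c (m + 1)` has derivative `(m + 1) c m`
(`derivative_succ`), which reduces every coefficient to a constant one. At `x = 0`, `R² = 1 - t²`
gives a two-term recurrence solved by double factorials. -/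

open Polynomial Finset

/-! ### Permutations compatible with a word -/

/-- The relation imposed on two consecutive labels by a step. -/
def StepRel {α : Type*} [LT α] (s : SignType) (a b : α) : Prop :=
  (s = -1 → a < b) ∧ (s = 1 → b < a)

/-- The sequence `f` of labels satisfies the constraints given by the letters of `w`. -/
def Compat {α : Type*} [LT α] (n : ℕ) (w : List SignType) (f : Fin n → α) : Prop :=
  ∀ (i : ℕ) (h : i + 1 < n), StepRel (w.getD i 0) (f ⟨i, by omega⟩) (f ⟨i + 1, h⟩)

open Classical in
/-- The number of permutations compatible with a word. -/
noncomputable def compatCount (n : ℕ) (w : List SignType) : ℕ :=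
  #{σ : Equiv.Perm (Fin n) | Compat n w σ}

theorem StepRel.swap {α : Type*} [LT α] (s : SignType) (a b : α) :
    StepRel (-s) b a ↔ StepRel s a b := by
  rcases s with _ | _ | _ <;> simp [StepRel]

theorem Compat.comp_strictMono {α β : Type*} [LinearOrder α] [LinearOrder β] {n : ℕ}
    {w : List SignType} {f : Fin n → α} {g : α → β} (hg : StrictMono g) :
    Compat n w (g ∘ f) ↔ Compat n w f := by
  simp only [Compat, StepRel, Function.comp, hg.lt_iff_lt]

-- Only the relative order of the labels matters: the permutation sorting `g` is absorbed into `τ`.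
open Classical in
theorem card_compat_comp {α : Type*} [LinearOrder α] {n : ℕ} (w : List SignType)
    {g : Fin n → α} (hg : Function.Injective g) :
    #{τ : Equiv.Perm (Fin n) | Compat n w (g ∘ τ)} = compatCount n w := by
  have hmono : StrictMono (g ∘ Tuple.sort g) :=
    (Tuple.monotone_sort g).strictMono_of_injective (hg.comp (Tuple.sort g).injective)
  refine Finset.card_equiv (Equiv.mulLeft (Tuple.sort g)⁻¹) fun τ => ?_
  simp only [mem_filter, mem_univ, true_and, Equiv.coe_mulLeft]
  rw [← Compat.comp_strictMono hmono]
  have : (g ∘ Tuple.sort g) ∘ ⇑((Tuple.sort g)⁻¹ * τ) = g ∘ τ := by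
    ext i; simp
  rw [this]

theorem compat_append {α : Type*} [LinearOrder α] (u v : List SignType) (s : SignType)
    (f : Fin ((u.length + 1) + (v.length + 1)) → α) :
    Compat _ (u ++ s :: v) f ↔
      Compat _ u (f ∘ Fin.castAdd (v.length + 1)) ∧
      StepRel s (f ⟨u.length, by omega⟩) (f ⟨u.length + 1, by omega⟩) ∧
      Compat _ v (f ∘ Fin.natAdd (u.length + 1)) := by
  constructor
  · intro h
    refine ⟨fun i hi => ?_, ?_, fun i hi => ?_⟩
    · have := h i (by omega)
      rwa [List.getD_append _ _ _ _ (by omega)] at this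
    · have := h u.length (by omega)
      rwa [List.getD_append_right _ _ _ _ le_rfl, Nat.sub_self, List.getD_cons_zero] at this
    · have := h (u.length + 1 + i) (by omega)
      rwa [List.getD_append_right _ _ _ _ (by omega),
        show u.length + 1 + i - u.length = i + 1 by omega, List.getD_cons_succ] at this
  · rintro ⟨h1, h2, h3⟩ i hi
    rcases lt_trichotomy i u.length with h | h | h
    · have := h1 i (by omega)
      rwa [List.getD_append _ _ _ _ h]
    · subst h
      rwa [List.getD_append_right _ _ _ _ le_rfl, Nat.sub_self, List.getD_cons_zero]
    · obtain ⟨j, rfl⟩ : ∃ j, i = u.length + 1 + j := ⟨i - (u.length + 1), by omega⟩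
      have := h3 j (by omega)
      rwa [List.getD_append_right _ _ _ _ (by omega),
        show u.length + 1 + j - u.length = j + 1 by omega, List.getD_cons_succ]

/-- The permutations compatible with a word with a letter `0` are split according to the order of
the two labels around this letter. -/
theorem compatCount_add (u v : List SignType) :
    compatCount ((u.length + 1) + (v.length + 1)) (u ++ 1 :: v) +
      compatCount ((u.length + 1) + (v.length + 1)) (u ++ (-1) :: v) =
      compatCount ((u.length + 1) + (v.length + 1)) (u ++ 0 :: v) := by
  classical
  unfold compatCount
  rw [← card_union_of_disjoint]
  · congr 1
    ext σ
    simp only [mem_union, mem_filter, mem_univ, true_and, compat_append]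
    have hne : σ ⟨u.length, by omega⟩ ≠ σ ⟨u.length + 1, by omega⟩ := by
      intro h; simpa using σ.injective h
    rcases lt_or_gt_of_ne hne with h | h <;> simp [StepRel, h, h.le]
  · rw [disjoint_filter]
    intro σ _ h1 h2
    rw [compat_append] at h1 h2
    exact lt_asymm (h1.2.1.2 rfl) (h2.2.1.1 rfl)

/-- Double counting of the pairs of a permutation `σ` and a rearrangement `p` of each of the two
blocks of positions such that `σ * T p` is compatible. For fixed `p`, right multiplication by `T p`
is a bijection; for fixed `σ`, the two blocks are constrained independently. -/
theorem compatCount_zero (u v : List SignType) :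
    (u.length + 1).factorial * (v.length + 1).factorial *
      compatCount ((u.length + 1) + (v.length + 1)) (u ++ 0 :: v) =
    ((u.length + 1) + (v.length + 1)).factorial *
      (compatCount (u.length + 1) u * compatCount (v.length + 1) v) := by
  classical
  set a := u.length + 1 with ha
  set b := v.length + 1 with hb
  let T : Equiv.Perm (Fin a) × Equiv.Perm (Fin b) → Equiv.Perm (Fin (a + b)) :=
    fun p => finSumFinEquiv.permCongr (Equiv.sumCongr p.1 p.2)
  have key : ∀ p (σ : Equiv.Perm (Fin (a + b))), Compat (a + b) (u ++ 0 :: v) ⇑(σ * T p) ↔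
      Compat a u ((σ ∘ Fin.castAdd b) ∘ p.1) ∧ Compat b v ((σ ∘ Fin.natAdd a) ∘ p.2) := by
    intro p σ
    rw [compat_append]
    have h1 : ⇑(σ * T p) ∘ Fin.castAdd b = (σ ∘ Fin.castAdd b) ∘ p.1 := by
      ext i; simp [T, Equiv.permCongr_apply]
    have h2 : ⇑(σ * T p) ∘ Fin.natAdd a = (σ ∘ Fin.natAdd a) ∘ p.2 := by
      ext i; simp [T, Equiv.permCongr_apply]
    change Compat a u (⇑(σ * T p) ∘ Fin.castAdd b) ∧ _ ∧
      Compat b v (⇑(σ * T p) ∘ Fin.natAdd a) ↔ _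
    rw [h1, h2]
    simp [StepRel]
  have h1 : ∀ p, #{σ : Equiv.Perm (Fin (a + b)) | Compat (a + b) (u ++ 0 :: v) ⇑(σ * T p)} =
      compatCount (a + b) (u ++ 0 :: v) := fun p =>
    Finset.card_equiv (Equiv.mulRight (T p)) fun σ => by
      simp only [mem_filter, mem_univ, true_and, Equiv.coe_mulRight]
  have h2 : ∀ σ : Equiv.Perm (Fin (a + b)),
      #{p | Compat (a + b) (u ++ 0 :: v) ⇑(σ * T p)} = compatCount a u * compatCount b v := by
    intro σ
    rw [← card_compat_comp u (g := σ ∘ Fin.castAdd b)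
        (σ.injective.comp (Fin.castAdd_injective a b)),
      ← card_compat_comp v (g := σ ∘ Fin.natAdd a)
        (σ.injective.comp (Fin.natAdd_injective b a)), ← card_product]
    congr 1
    ext p
    simp only [mem_filter, mem_univ, true_and, mem_product, key]
  have h3 := Finset.sum_card_bipartiteAbove_eq_sum_card_bipartiteBelow
    (s := (univ : Finset (Equiv.Perm (Fin a) × Equiv.Perm (Fin b))))
    (t := (univ : Finset (Equiv.Perm (Fin (a + b)))))
    (fun p σ => Compat (a + b) (u ++ 0 :: v) ⇑(σ * T p))
  simp only [bipartiteAbove, bipartiteBelow, h1, h2, sum_const, card_univ, smul_eq_mul,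
    Fintype.card_prod, Fintype.card_perm, Fintype.card_fin] at h3
  exact h3

/-! ### Reversal of words -/

/-- The word of the reversed path. -/
def revNeg (w : List SignType) : List SignType := (w.map (- ·)).reverse

@[simp] theorem length_revNeg (w : List SignType) : (revNeg w).length = w.length := by
  simp [revNeg]

@[simp] theorem revNeg_revNeg (w : List SignType) : revNeg (revNeg w) = w := by
  simp [revNeg]

@[simp] theorem revNeg_append (u v : List SignType) : revNeg (u ++ v) = revNeg v ++ revNeg u := by
  simp [revNeg]

@[simp] theorem revNeg_cons (s : SignType) (v : List SignType) :
    revNeg (s :: v) = revNeg v ++ [-s] := by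
  simp [revNeg]

@[simp] theorem revNeg_nil : revNeg [] = [] := rfl

theorem count_zero_revNeg (w : List SignType) : (revNeg w).count 0 = w.count 0 := by
  rw [revNeg, List.count_reverse]
  exact List.count_map_of_injective _ _ neg_injective (0 : SignType)

theorem Compat.rev {α : Type*} [LinearOrder α] {w : List SignType} {n : ℕ}
    (hn : w.length + 1 = n) {f : Fin n → α} (h : Compat n w f) :
    Compat n (revNeg w) (f ∘ Fin.rev) := by
  intro i hi
  have := h (w.length - (i + 1)) (by omega)
  rw [← StepRel.swap] at this
  convert this using 1
  · rw [revNeg, List.getD_eq_getElem _ _ (by simp; omega), List.getD_eq_getElem _ _ (by omega)]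
    simp only [List.getElem_reverse, List.getElem_map, List.length_map]
    congr 2
    omega
  all_goals
    refine congrArg f (Fin.ext ?_)
    simp only [Fin.val_rev]
    omega

theorem compatCount_revNeg (w : List SignType) :
    compatCount (w.length + 1) (revNeg w) = compatCount (w.length + 1) w := by
  classical
  symm
  refine Finset.card_equiv (Equiv.mulRight Fin.revPerm) fun σ => ?_
  simp only [mem_filter, mem_univ, true_and, Equiv.coe_mulRight]
  refine ⟨fun h => h.rev rfl, fun h => ?_⟩
  have h' := Compat.rev (by simp) h
  rw [revNeg_revNeg] at h'
  have e : ⇑(σ * Fin.revPerm : Equiv.Perm (Fin (w.length + 1))) ∘ Fin.rev = σ := by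
    ext i; simp
  rwa [e] at h'

/-! ### Weights and their product rules -/

/-- The normalized weight of a word. -/
noncomputable def wordWeight (w : List SignType) : ℚ[X] :=
  C ((compatCount (w.length + 1) w : ℚ) / (w.length + 1).factorial) * X ^ w.count 0

theorem wordWeight_nil : wordWeight [] = 1 := by
  have : compatCount 1 [] = 1 := by
    classical
    unfold compatCount
    rw [filter_true_of_mem]
    · simp
    · intro σ _ i hi; omega
  simp [wordWeight, this]

theorem wordWeight_revNeg (w : List SignType) : wordWeight (revNeg w) = wordWeight w := by
  simp only [wordWeight, length_revNeg, compatCount_revNeg, count_zero_revNeg]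

theorem compatCount_zero_div (u v : List SignType) :
    (compatCount (u.length + (v.length + 1) + 1) (u ++ 0 :: v) : ℚ) /
      (u.length + (v.length + 1) + 1).factorial =
    (compatCount (u.length + 1) u : ℚ) / (u.length + 1).factorial *
      ((compatCount (v.length + 1) v : ℚ) / (v.length + 1).factorial) := by
  have h := compatCount_zero u v
  rw [show u.length + 1 + (v.length + 1) = u.length + (v.length + 1) + 1 by ring] at h
  have h' : ((u.length + 1).factorial * (v.length + 1).factorial *
      compatCount (u.length + (v.length + 1) + 1) (u ++ 0 :: v) : ℚ) =
    (u.length + (v.length + 1) + 1).factorial *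
      (compatCount (u.length + 1) u * compatCount (v.length + 1) v) := by exact_mod_cast h
  rw [div_mul_div_comm, div_eq_div_iff (by positivity) (by positivity)]
  linarith

theorem wordWeight_zero (u v : List SignType) :
    wordWeight (u ++ 0 :: v) = X * (wordWeight u * wordWeight v) := by
  have h := compatCount_zero_div u v
  simp only [wordWeight, List.length_append, List.length_cons, List.count_append,
    List.count_cons_self, h, C_mul]
  ring

theorem wordWeight_add (u v : List SignType) :
    wordWeight (u ++ 1 :: v) + wordWeight (u ++ (-1) :: v) = wordWeight u * wordWeight v := by
  have h := compatCount_zero_div u v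
  have h2 := compatCount_add u v
  rw [show u.length + 1 + (v.length + 1) = u.length + (v.length + 1) + 1 by ring] at h2
  have h3 : ((compatCount (u.length + (v.length + 1) + 1) (u ++ 1 :: v) : ℚ) +
    compatCount (u.length + (v.length + 1) + 1) (u ++ (-1) :: v)) =
    compatCount (u.length + (v.length + 1) + 1) (u ++ 0 :: v) := by exact_mod_cast h2
  rw [← h3, add_div] at h
  have e1 : (1 :: v).count (0 : SignType) = v.count 0 := List.count_cons_of_ne (by decide)
  have e2 : ((-1) :: v).count (0 : SignType) = v.count 0 := List.count_cons_of_ne (by decide)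
  simp only [wordWeight, List.length_append, List.length_cons, List.count_append, e1, e2]
  rw [← add_mul, ← C_add, h, C_mul]
  ring

/-! ### Excursions and the first-return decomposition -/

/-- The final height of a word. -/
def wordHeight (w : List SignType) : ℤ := (w.map (SignType.cast : SignType → ℤ)).sum

@[simp] theorem wordHeight_nil : wordHeight [] = 0 := rfl

@[simp] theorem wordHeight_cons (s : SignType) (w : List SignType) :
    wordHeight (s :: w) = s + wordHeight w := by simp [wordHeight]

@[simp] theorem wordHeight_append (u v : List SignType) :
    wordHeight (u ++ v) = wordHeight u + wordHeight v := by simp [wordHeight]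

@[simp] theorem wordHeight_revNeg (w : List SignType) :
    wordHeight (revNeg w) = - wordHeight w := by
  induction w with
  | nil => simp
  | cons s w ih => rcases s with _ | _ | _ <;> simp [ih]

/-- Words of paths from height `0` to height `0` that stay at non-negative heights. -/
def IsExcursion (e : List SignType) : Prop :=
  wordHeight e = 0 ∧ ∀ i, 0 ≤ wordHeight (e.take i)

theorem IsExcursion.revNeg {e : List SignType} (h : IsExcursion e) : IsExcursion (revNeg e) := by
  refine ⟨by simp [h.1], fun i => ?_⟩
  have h1 : (_root_.revNeg e).take i = _root_.revNeg (e.drop (e.length - i)) := by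
    simp [_root_.revNeg, List.take_reverse, List.map_drop]
  have h2 := wordHeight_append (e.take (e.length - i)) (e.drop (e.length - i))
  rw [List.take_append_drop, h.1] at h2
  rw [h1, wordHeight_revNeg]
  linarith [h.2 (e.length - i)]

theorem isExcursion_nil : IsExcursion [] := ⟨rfl, by simp⟩

theorem isExcursion_zero_cons {e : List SignType} : IsExcursion (0 :: e) ↔ IsExcursion e := by
  refine and_congr (by simp) ⟨fun h i => by simpa using h (i + 1), fun h i => ?_⟩
  rcases i with _ | i
  · simp
  · simpa using h i

theorem not_isExcursion_neg_one_cons (e : List SignType) : ¬ IsExcursion ((-1) :: e) := by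
  intro h
  have := h.2 1
  simp at this

theorem IsExcursion.arch {u v : List SignType} (hu : IsExcursion u) (hv : IsExcursion v) :
    IsExcursion (1 :: (u ++ (-1) :: v)) := by
  refine ⟨by simp [hu.1, hv.1], fun i => ?_⟩
  rcases i with _ | i
  · simp
  · rw [List.take_succ_cons, wordHeight_cons, List.take_append, wordHeight_append]
    have h1 := hu.2 i
    rcases h : i - u.length with _ | j
    · simp; omega
    · have h2 := hv.2 j
      rw [List.take_of_length_le (by omega), hu.1]
      simpa using h2

theorem IsExcursion.exists_arch {w : List SignType} (h : IsExcursion (1 :: w)) :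
    ∃ u v, IsExcursion u ∧ IsExcursion v ∧ w = u ++ (-1) :: v := by
  have hw : wordHeight w = -1 := by
    have := h.1
    simp at this
    omega
  have hge : ∀ i, -1 ≤ wordHeight (w.take i) := fun i => by
    have := h.2 (i + 1)
    simp at this
    omega
  -- The arch closes at the first passage of `w` below `0`; steps being at least `-1`, this passage
  -- is a step `-1` from height `0`.
  have hex : ∃ i, wordHeight (w.take i) < 0 := ⟨w.length, by simp [hw]⟩
  classical
  obtain ⟨j, hj⟩ : ∃ j, Nat.find hex = j + 1 := by
    refine Nat.exists_eq_succ_of_ne_zero fun h0 => ?_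
    have := Nat.find_spec hex
    simp [h0] at this
  have hneg : wordHeight (w.take (j + 1)) < 0 := hj ▸ Nat.find_spec hex
  have hnn : ∀ i ≤ j, 0 ≤ wordHeight (w.take i) := fun i hi =>
    not_lt.1 (Nat.find_min hex (by omega))
  have hjl : j < w.length := by
    by_contra hlt
    have h1 := hnn j le_rfl
    rw [List.take_of_length_le (by omega)] at h1
    omega
  have hj0 := hnn j le_rfl
  have hj1 := hge (j + 1)
  rw [List.take_succ_eq_append_getElem hjl, wordHeight_append] at hneg hj1
  have hs : w[j] = -1 ∧ wordHeight (w.take j) = 0 := by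
    generalize w[j] = s at hneg hj1
    rcases s with _ | _ | _ <;> simp at hneg hj1 ⊢ <;> omega
  have hsplit : w = w.take j ++ (-1) :: w.drop (j + 1) := by
    rw [← hs.1, ← List.drop_eq_getElem_cons hjl, List.take_append_drop]
  refine ⟨w.take j, w.drop (j + 1), ⟨hs.2, fun i => ?_⟩, ⟨?_, fun i => ?_⟩, hsplit⟩
  · rw [List.take_take]
    exact hnn _ (min_le_right _ _)
  · have h1 := congrArg wordHeight hsplit
    simp [hs.2, hw] at h1
    exact h1
  · have h1 := hge (j + 1 + i)
    rw [List.take_add, List.take_succ_eq_append_getElem hjl, hs.1] at h1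
    simp [hs.2] at h1
    exact h1

/-- A longer `u'` would have the prefix `u ++ [-1]`, which ends at height `-1`. -/
theorem IsExcursion.arch_length_le {u u' v v' : List SignType} (hu : IsExcursion u)
    (hu' : IsExcursion u') (h : u ++ (-1) :: v = u' ++ (-1) :: v') : u'.length ≤ u.length := by
  by_contra! hlt
  have h1 := congrArg (List.take (u.length + 1)) h
  rw [List.take_append_of_le_length (l₁ := u') (by omega), List.take_append,
    List.take_of_length_le (by omega), Nat.add_sub_cancel_left] at h1
  have h2 := hu'.2 (u.length + 1)
  rw [← h1] at h2
  simp [hu.1] at h2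

theorem IsExcursion.arch_injective {u u' v v' : List SignType} (hu : IsExcursion u)
    (hu' : IsExcursion u') (h : u ++ (-1) :: v = u' ++ (-1) :: v') : u = u' ∧ v = v' := by
  have := List.append_inj h (le_antisymm (hu'.arch_length_le hu h.symm) (hu.arch_length_le hu' h))
  simpa using this

open Classical in
/-- The excursions of a given length. -/
noncomputable def excursions (m : ℕ) : Finset (List SignType) :=
  (List.finite_length_eq SignType m).toFinset.filter IsExcursion

theorem mem_excursions {m : ℕ} {e : List SignType} :
    e ∈ excursions m ↔ e.length = m ∧ IsExcursion e := by
  simp [excursions]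

theorem excursions_zero : excursions 0 = {[]} := by
  ext e
  rw [mem_excursions, List.length_eq_zero_iff, mem_singleton]
  exact ⟨fun h => h.1, fun h => ⟨h, h ▸ isExcursion_nil⟩⟩

theorem sum_revNeg_excursions {M : Type*} [AddCommMonoid M] (m : ℕ) (f : List SignType → M) :
    ∑ e ∈ excursions m, f (revNeg e) = ∑ e ∈ excursions m, f e := by
  have h : ∀ e ∈ excursions m, revNeg e ∈ excursions m := fun e he => by
    rw [mem_excursions] at he ⊢
    exact ⟨by simp [he.1], he.2.revNeg⟩
  exact sum_nbij' revNeg revNeg h h (by simp) (by simp) (by simp)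

theorem sum_excursions_one {M : Type*} [AddCommMonoid M] (f : List SignType → M) :
    ∑ e ∈ excursions 1, f e = f [0] := by
  have : excursions 1 = {[0]} := by
    ext e
    rw [mem_excursions, mem_singleton]
    constructor
    · rintro ⟨h1, h2⟩
      obtain ⟨s, rfl⟩ := List.length_eq_one_iff.1 h1
      have := h2.1
      rcases s with _ | _ | _ <;> simp at this ⊢
    · rintro rfl
      exact ⟨rfl, isExcursion_zero_cons.2 isExcursion_nil⟩
  rw [this, sum_singleton]

theorem sum_excursions_add_two {M : Type*} [AddCommMonoid M] (m : ℕ) (f : List SignType → M) :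
    ∑ e ∈ excursions (m + 2), f e = ∑ e ∈ excursions (m + 1), f (0 :: e) +
      ∑ p ∈ antidiagonal m, ∑ u ∈ excursions p.1, ∑ v ∈ excursions p.2,
        f (1 :: (u ++ (-1) :: v)) := by
  classical
  rw [← sum_filter_add_sum_filter_not (excursions (m + 2)) (fun e => e.head? = some 0)]
  congr 1
  · symm
    refine sum_nbij (fun e => 0 :: e) (fun e he => ?_) (fun a _ b _ h => by simpa using h)
      (fun e he => ?_) (fun _ _ => rfl)
    · rw [mem_excursions] at he
      simp [mem_excursions, isExcursion_zero_cons, he]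
    · rw [mem_coe, mem_filter, mem_excursions] at he
      obtain ⟨⟨h1, h2⟩, h3⟩ := he
      rcases e with _ | ⟨s, e⟩
      · simp at h3
      · simp only [List.head?_cons, Option.some.injEq] at h3
        subst h3
        exact ⟨e, by simpa [mem_excursions, isExcursion_zero_cons] using ⟨by simpa using h1,
          isExcursion_zero_cons.1 h2⟩, rfl⟩
  · simp_rw [← sum_product']
    rw [sum_sigma']
    symm
    refine sum_nbij (fun x => 1 :: (x.2.1 ++ (-1) :: x.2.2)) ?_ ?_ ?_ (fun _ _ => rfl)
    · rintro ⟨⟨i, j⟩, u, v⟩ h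
      simp only [mem_sigma, HasAntidiagonal.mem_antidiagonal, mem_product, mem_excursions] at h
      obtain ⟨h1, ⟨h2, h3⟩, h4, h5⟩ := h
      simp only [mem_filter, mem_excursions, List.length_cons, List.length_append,
        List.head?_cons]
      exact ⟨⟨by omega, h3.arch h5⟩, by simp⟩
    · rintro ⟨⟨i, j⟩, u, v⟩ h ⟨⟨i', j'⟩, u', v'⟩ h' heq
      simp only [mem_coe, mem_sigma,
        HasAntidiagonal.mem_antidiagonal, mem_product, mem_excursions] at h h'
      obtain ⟨rfl, rfl⟩ := h.2.1.2.arch_injective h'.2.1.2 (List.cons_injective heq)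
      obtain ⟨-, ⟨rfl, -⟩, rfl, -⟩ := h
      obtain ⟨-, ⟨rfl, -⟩, rfl, -⟩ := h'
      rfl
    · intro e he
      rw [mem_coe, mem_filter, mem_excursions] at he
      obtain ⟨⟨h1, h2⟩, h3⟩ := he
      rcases e with _ | ⟨s, e⟩
      · simp at h1
      · rcases s with _ | _ | _
        · exact absurd rfl h3
        · exact absurd h2 (not_isExcursion_neg_one_cons e)
        · obtain ⟨u, v, hu, hv, rfl⟩ := IsExcursion.exists_arch h2
          refine ⟨⟨(u.length, v.length), u, v⟩, ?_, rfl⟩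
          simp only [List.length_cons, List.length_append] at h1
          simp only [mem_coe, mem_sigma,
            HasAntidiagonal.mem_antidiagonal, mem_product, mem_excursions]
          exact ⟨by omega, ⟨trivial, hu⟩, trivial, hv⟩

/-! ### Quadratic recurrence for the counting polynomials -/

/-- The normalized generating polynomial of the well-labelled Motzkin paths of size `m + 2`. -/
noncomputable def motzkinPoly (m : ℕ) : ℚ[X] :=
  ∑ e ∈ excursions m, wordWeight (e ++ [-1])

/-- The words `[1]` and `[-1]` are reverses of each other, so they share the total weight `1`
equally. -/
theorem motzkinPoly_zero : 2 * motzkinPoly 0 = 1 := by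
  have h := wordWeight_add [] []
  have h2 := wordWeight_revNeg [-1]
  simp only [List.nil_append, wordWeight_nil, revNeg_cons, revNeg_nil, neg_neg] at h h2
  rw [motzkinPoly, excursions_zero, sum_singleton, List.nil_append]
  linear_combination h - h2

theorem wordWeight_zero_cons (v : List SignType) : wordWeight (0 :: v) = X * wordWeight v := by
  simpa [wordWeight_nil] using wordWeight_zero [] v

theorem motzkinPoly_one : motzkinPoly 1 = X * motzkinPoly 0 := by
  rw [motzkinPoly, motzkinPoly, sum_excursions_one, excursions_zero, sum_singleton]
  exact wordWeight_zero_cons _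

/-- Changing the step that first returns to the ground from `-1` into `1` and reversing the path
gives again a path starting with an arch. -/
theorem two_mul_sum_wordWeight_arch (m : ℕ) :
    2 * ∑ p ∈ antidiagonal m, ∑ u ∈ excursions p.1, ∑ v ∈ excursions p.2,
        wordWeight (1 :: (u ++ (-1) :: v) ++ [-1]) =
      ∑ p ∈ antidiagonal m, motzkinPoly p.1 * motzkinPoly p.2 := by
  -- The reverse of `1 u 1 v (-1)` is `1 v' (-1) u' (-1)`, where `u'` and `v'` are the reversed
  -- excursions; the sum is invariant under this exchange and reversal of `u` and `v`.
  have hflip : ∑ p ∈ antidiagonal m, ∑ u ∈ excursions p.1, ∑ v ∈ excursions p.2,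
        wordWeight (1 :: (u ++ (-1) :: v) ++ [-1]) =
      ∑ p ∈ antidiagonal m, ∑ u ∈ excursions p.1, ∑ v ∈ excursions p.2,
        wordWeight (1 :: u ++ 1 :: (v ++ [-1])) := by
    rw [← Nat.sum_antidiagonal_swap]
    refine sum_congr rfl fun p _ => ?_
    rw [sum_comm, ← sum_revNeg_excursions]
    refine sum_congr rfl fun u _ => ?_
    rw [← sum_revNeg_excursions]
    refine sum_congr rfl fun v _ => ?_
    rw [← wordWeight_revNeg]
    simp
  have hprod : ∀ i, motzkinPoly i = ∑ u ∈ excursions i, wordWeight (1 :: u) := by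
    intro i
    rw [motzkinPoly, ← sum_revNeg_excursions]
    refine sum_congr rfl fun u _ => ?_
    rw [← wordWeight_revNeg]
    simp
  rw [two_mul]
  nth_rewrite 1 [hflip]
  rw [← sum_add_distrib]
  refine sum_congr rfl fun p _ => ?_
  rw [hprod p.1, motzkinPoly, sum_mul_sum, ← sum_add_distrib]
  refine sum_congr rfl fun u _ => ?_
  rw [← sum_add_distrib]
  -- The two words now differ only in the letter between `1 u` and `v (-1)`, so their weights add up
  -- to a product.
  refine sum_congr rfl fun v _ => ?_
  rw [← wordWeight_add]
  simp

theorem motzkinPoly_add_two (m : ℕ) : 2 * motzkinPoly (m + 2) =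
    2 * X * motzkinPoly (m + 1) + ∑ p ∈ antidiagonal m, motzkinPoly p.1 * motzkinPoly p.2 := by
  rw [← two_mul_sum_wordWeight_arch, motzkinPoly, sum_excursions_add_two, mul_add, motzkinPoly]
  congr 1
  rw [mul_assoc, mul_sum (a := X)]
  congr 1
  exact sum_congr rfl fun e _ => wordWeight_zero_cons _

/-! ### Solving the quadratic recurrence by power series -/

/-- Coefficientwise differentiation of a power series with polynomial coefficients. -/
noncomputable def coeffDeriv (f : PowerSeries ℚ[X]) : PowerSeries ℚ[X] :=
  PowerSeries.mk fun n => derivative (PowerSeries.coeff n f)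

theorem coeffDeriv_mul (f g : PowerSeries ℚ[X]) :
    coeffDeriv (f * g) = coeffDeriv f * g + f * coeffDeriv g := by
  ext1 n
  simp only [coeffDeriv, PowerSeries.coeff_mk, PowerSeries.coeff_mul, map_add, derivative_sum,
    derivative_mul, sum_add_distrib]


theorem PowerSeries.two_ne_zero' {R : Type*} [CommRing R] [NeZero (2 : R)] :
    (2 : PowerSeries R) ≠ 0 := by
  rw [← map_ofNat PowerSeries.C 2, ne_eq, map_eq_zero_iff _ PowerSeries.C_injective]
  exact two_ne_zero

/-- The quadratic recurrence satisfied by the normalized counting polynomials. -/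
structure QuadRec (c : ℕ → ℚ[X]) : Prop where
  zero : 2 * c 0 = 1
  one : c 1 = X * c 0
  add_two : ∀ m, 2 * c (m + 2) = 2 * X * c (m + 1) + ∑ p ∈ antidiagonal m, c p.1 * c p.2

namespace QuadRec

/-- `1 - x t - t² ∑ cₘ tᵐ` -/
noncomputable def root (c : ℕ → ℚ[X]) : PowerSeries ℚ[X] :=
  1 - PowerSeries.C X * PowerSeries.X - PowerSeries.X ^ 2 * PowerSeries.mk c

theorem coeff_root_zero (c : ℕ → ℚ[X]) : PowerSeries.coeff 0 (root c) = 1 := by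
  simp [root]

theorem root_ne_zero (c : ℕ → ℚ[X]) : root c ≠ 0 := by
  intro h
  simpa [h] using coeff_root_zero c

theorem coeff_root_add_two (c : ℕ → ℚ[X]) (m : ℕ) :
    PowerSeries.coeff (m + 2) (root c) = - c m := by
  simp [root, PowerSeries.coeff_X_pow_mul, PowerSeries.coeff_one]

variable {c : ℕ → ℚ[X]}

theorem series_eq (hc : QuadRec c) :
    2 * PowerSeries.mk c = 1 + PowerSeries.X ^ 2 * (PowerSeries.mk c * PowerSeries.mk c) +
      2 * PowerSeries.C X * PowerSeries.X * PowerSeries.mk c := by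
  have h2 : (2 : PowerSeries ℚ[X]) = PowerSeries.C 2 := (map_ofNat PowerSeries.C 2).symm
  ext1 n
  rw [h2, ← map_mul, mul_assoc (PowerSeries.C (2 * X))]
  simp only [map_add, PowerSeries.coeff_C_mul, PowerSeries.coeff_mk]
  have hX0 : PowerSeries.coeff 1 (PowerSeries.X * PowerSeries.mk c) = c 0 :=
    (PowerSeries.coeff_succ_X_mul 0 _).trans (PowerSeries.coeff_mk _ _)
  have hX1 : ∀ m, PowerSeries.coeff (m + 2) (PowerSeries.X * PowerSeries.mk c) = c (m + 1) :=
    fun m => (PowerSeries.coeff_succ_X_mul (m + 1) _).trans (PowerSeries.coeff_mk _ _)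
  rcases n with _ | _ | m
  · simp [hc.zero]
  · rw [zero_add, hc.one, hX0,
      PowerSeries.coeff_X_pow_mul']
    simp [PowerSeries.coeff_one]
    ring
  · rw [add_assoc, one_add_one_eq_two, hc.add_two, PowerSeries.coeff_X_pow_mul, PowerSeries.coeff_mul, hX1]
    simp [PowerSeries.coeff_one]
    ring

/-- Completing the square in the quadratic equation for the series. -/
theorem root_sq (hc : QuadRec c) :
    root c * root c =
      (1 - PowerSeries.C X * PowerSeries.X) * (1 - PowerSeries.C X * PowerSeries.X)
        - PowerSeries.X * PowerSeries.X := by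
  have := hc.series_eq
  unfold root
  linear_combination (-PowerSeries.X ^ 2) * this

/-- Differentiating `root_sq` in each variable expresses both partial derivatives times `root c` as
polynomials. The identity is then checked after multiplication by `root c`, which is cancellable. -/
theorem coeffDeriv_root (hc : QuadRec c) :
    coeffDeriv (root c) =
      PowerSeries.X * (PowerSeries.X * PowerSeries.derivative ℚ[X] (root c) - root c) := by
  have hsq := hc.root_sq
  have hx : coeffDeriv (root c) * root c =
      - PowerSeries.X * (1 - PowerSeries.C X * PowerSeries.X) := by
    have h := congrArg coeffDeriv hsq
    have h3 : coeffDeriv ((1 - PowerSeries.C X * PowerSeries.X) *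
        (1 - PowerSeries.C X * PowerSeries.X) - PowerSeries.X * PowerSeries.X) =
        2 * (- PowerSeries.X * (1 - PowerSeries.C X * PowerSeries.X)) := by
      have hsub : ∀ f g, coeffDeriv (f - g) = coeffDeriv f - coeffDeriv g := by
        intro f g; ext1 n; simp [coeffDeriv]
      have hX : coeffDeriv PowerSeries.X = 0 := by
        ext1 n; simp only [coeffDeriv, PowerSeries.coeff_mk, PowerSeries.coeff_X]
        split_ifs <;> simp
      have hone : coeffDeriv 1 = 0 := by
        ext1 n; simp only [coeffDeriv, PowerSeries.coeff_mk, PowerSeries.coeff_one]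
        split_ifs <;> simp
      have hC : coeffDeriv (PowerSeries.C X) = 1 := by
        ext1 n; simp only [coeffDeriv, PowerSeries.coeff_mk, PowerSeries.coeff_C,
          PowerSeries.coeff_one]
        split_ifs <;> simp
      rw [hsub, coeffDeriv_mul, coeffDeriv_mul, hsub, coeffDeriv_mul, hX, hone, hC]
      ring
    rw [h3, coeffDeriv_mul] at h
    have h2 : (2 : PowerSeries ℚ[X]) ≠ 0 := PowerSeries.two_ne_zero'
    apply mul_left_cancel₀ h2
    linear_combination h
  have ht : PowerSeries.derivative ℚ[X] (root c) * root c =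
      - PowerSeries.C X * (1 - PowerSeries.C X * PowerSeries.X) - PowerSeries.X := by
    have h := congrArg (PowerSeries.derivative ℚ[X]) hsq
    simp only [Derivation.leibniz, map_sub, Derivation.map_one_eq_zero, PowerSeries.derivative_C,
      PowerSeries.derivative_X, smul_eq_mul] at h
    have h2 : (2 : PowerSeries ℚ[X]) ≠ 0 := PowerSeries.two_ne_zero'
    apply mul_left_cancel₀ h2
    linear_combination h
  apply mul_right_cancel₀ (root_ne_zero c)
  linear_combination hx - PowerSeries.X * PowerSeries.X * ht + PowerSeries.X * hsq

/-- Coefficient of `t ^ (m + 3)` in `coeffDeriv_root`: the operator `t ∂ₜ - 1` multiplies `t ^ (m +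
2)` by `m + 1`. -/
theorem derivative_succ (hc : QuadRec c) (m : ℕ) :
    derivative (c (m + 1)) = (m + 1) * c m := by
  have h := congrArg (PowerSeries.coeff (m + 3)) hc.coeffDeriv_root
  rw [PowerSeries.coeff_succ_X_mul, map_sub, PowerSeries.coeff_succ_X_mul,
    PowerSeries.coeff_derivative, coeff_root_add_two, coeffDeriv, PowerSeries.coeff_mk,
    coeff_root_add_two] at h
  simp only [derivative_neg] at h
  push_cast at h
  linear_combination -h

theorem coeff_succ (hc : QuadRec c) (m k : ℕ) :
    ((k : ℚ) + 1) * (c (m + 1)).coeff (k + 1) = (m + 1) * (c m).coeff k := by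
  have h := congrArg (fun p => p.coeff k) (hc.derivative_succ m)
  have e : ((m : ℚ[X]) + 1) = C ((m : ℚ) + 1) := by simp
  simp only [coeff_derivative, e, coeff_C_mul] at h
  linarith

/-- At `x = 0` the root becomes `G` with `G² = 1 - t²`, whence `(1 - t²) G' = - t G`; compare the
coefficients of `t ^ (m + 3)`. -/
theorem coeff_zero_add_two (hc : QuadRec c) (m : ℕ) :
    ((m : ℚ) + 4) * (c (m + 2)).coeff 0 = (m + 1) * (c m).coeff 0 := by
  have hsq := congrArg (PowerSeries.map constantCoeff) hc.root_sq
  set G := PowerSeries.map constantCoeff (root c) with hG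
  simp only [map_mul, map_sub, map_one, PowerSeries.map_C, PowerSeries.map_X,
    constantCoeff_apply, coeff_X_zero, map_zero, zero_mul, sub_zero, ← hG] at hsq
  have hG0 : G ≠ 0 := by
    intro h
    have := congrArg (PowerSeries.coeff 0) h
    rw [hG, PowerSeries.coeff_map, coeff_root_zero] at this
    simp at this
  have ht : PowerSeries.derivative ℚ G * G = - PowerSeries.X := by
    have h := congrArg (PowerSeries.derivative ℚ) hsq
    simp only [Derivation.leibniz, map_sub, Derivation.map_one_eq_zero, 
      PowerSeries.derivative_X, smul_eq_mul] at h
    have h2 : (2 : PowerSeries ℚ) ≠ 0 := PowerSeries.two_ne_zero'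
    apply mul_left_cancel₀ h2
    linear_combination h
  have key : PowerSeries.derivative ℚ G -
      PowerSeries.X * (PowerSeries.X * PowerSeries.derivative ℚ G) = - (PowerSeries.X * G) := by
    apply mul_right_cancel₀ hG0
    linear_combination (1 - PowerSeries.X * PowerSeries.X) * ht + PowerSeries.X * hsq
  have hco : ∀ n, PowerSeries.coeff (n + 2) G = - (c n).coeff 0 := by
    intro n
    rw [hG, PowerSeries.coeff_map, coeff_root_add_two]
    simp
  have h := congrArg (PowerSeries.coeff (m + 3)) key
  rw [map_neg, map_sub, PowerSeries.coeff_succ_X_mul, PowerSeries.coeff_succ_X_mul,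
    PowerSeries.coeff_succ_X_mul,
    PowerSeries.coeff_derivative, PowerSeries.coeff_derivative, hco, hco] at h
  push_cast at h
  linear_combination -h

/-- The closed form of the coefficients. -/
theorem factorial_mul_coeff_zero (hc : QuadRec c) (m : ℕ) :
    ((m + 2).factorial : ℚ) * (c m).coeff 0 =
      if Even m then ((m + 1).doubleFactorial * (m - 1).doubleFactorial : ℚ) else 0 := by
  induction m using Nat.twoStepInduction with
  | zero =>
    have h := congrArg (fun p => p.coeff 0) hc.zero
    have e : (2 : ℚ[X]) = C 2 := (map_ofNat C 2).symm
    simp only [e, coeff_C_mul, coeff_one_zero] at h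
    simp [h]
  | one => simp [hc.one]
  | more m ih _ =>
    have h := hc.coeff_zero_add_two m
    have e : (((m + 2 + 2).factorial : ℕ) : ℚ) = (m + 4) * (m + 3) * ((m + 2).factorial) := by
      rw [Nat.factorial_succ, Nat.factorial_succ (m + 2)]; push_cast; ring
    have h4 : ((m + 2 + 2).factorial : ℚ) * (c (m + 2)).coeff 0 =
        (m + 3) * (m + 1) * (((m + 2).factorial : ℚ) * (c m).coeff 0) := by
      rw [e]; linear_combination (m + 3) * ((m + 2).factorial : ℚ) * h
    rw [h4, ih]
    have hev : Even (m + 2) ↔ Even m := by simp [parity_simps]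
    simp only [hev]
    split_ifs with hm
    · have e1 : (m + 2 + 1).doubleFactorial = (m + 3) * (m + 1).doubleFactorial :=
        Nat.doubleFactorial_add_two (m + 1)
      have e2 : (m + 2 - 1).doubleFactorial = (m + 1) * (m - 1).doubleFactorial := by
        rcases m with _ | m
        · rfl
        · exact Nat.doubleFactorial_add_two m
      rw [e1, e2]
      push_cast
      ring
    · simp

theorem factorial_mul_coeff (hc : QuadRec c) (m k : ℕ) :
    ((m + 2).factorial : ℚ) * (c m).coeff k =
      if Even (((m + 2 : ℕ) : ℤ) - k) then
        (((m + 2).choose k * (m + 2 - 2).choose k * k.factorial *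
          intDoubleFactorial (((m + 2 : ℕ) : ℤ) - k - 1) *
          intDoubleFactorial (((m + 2 : ℕ) : ℤ) - k - 3) : ℕ) : ℚ)
      else 0 := by
  induction k generalizing m with
  | zero =>
    rw [hc.factorial_mul_coeff_zero]
    have e : Even (((m + 2 : ℕ) : ℤ) - (0 : ℕ)) ↔ Even m := by
      simp [parity_simps]
    have e1 : (((m + 2 : ℕ) : ℤ) - (0 : ℕ) - 1).toNat = m + 1 := by omega
    -- For `m = 0` both sides truncate to `0`, and `0!! = 1` agrees with `(-1)!! = 1`.
    have e2 : (((m + 2 : ℕ) : ℤ) - (0 : ℕ) - 3).toNat = m - 1 := by omega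
    simp only [e, intDoubleFactorial, e1, e2]
    simp
  | succ k ih =>
    rcases m with _ | m
    -- Here `c 0` is the constant `1 / 2`, and on the right `Nat.choose 0 (k + 1)` vanishes.
    · have h := hc.zero
      have e : c 0 = C (1 / 2) := by
        apply mul_left_cancel₀ (two_ne_zero : (2 : ℚ[X]) ≠ 0)
        rw [h, ← map_ofNat C 2, ← C_mul]; norm_num
      simp [e]
    · have h := hc.coeff_succ m k
      have e : (((m + 1 + 2 : ℕ) : ℤ) - ((k + 1 : ℕ) : ℤ)) = ((m + 2 : ℕ) : ℤ) - k := by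
        push_cast; ring
      have hk : (k : ℚ) + 1 ≠ 0 := by positivity
      apply mul_left_cancel₀ hk
      have h4 : ((k : ℚ) + 1) * (((m + 1 + 2).factorial : ℚ) * (c (m + 1)).coeff (k + 1)) =
          (m + 3) * (m + 1) * (((m + 2).factorial : ℚ) * (c m).coeff k) := by
        rw [show m + 1 + 2 = (m + 2) + 1 by ring, Nat.factorial_succ]
        push_cast
        linear_combination (m + 3) * ((m + 2).factorial : ℚ) * h
      rw [h4, ih, e]
      split_ifs
      · have c1 : ((m + 3 : ℕ) : ℚ) * (m + 2).choose k = (m + 3).choose (k + 1) * (k + 1 : ℕ) := by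
          exact_mod_cast Nat.add_one_mul_choose_eq (m + 2) k
        have c2 : ((m + 1 : ℕ) : ℚ) * m.choose k = (m + 1).choose (k + 1) * (k + 1 : ℕ) := by
          exact_mod_cast Nat.add_one_mul_choose_eq m k
        simp only [Nat.add_sub_cancel, Nat.factorial_succ]
        rw [show m + 1 + 2 = m + 3 by ring]
        push_cast at c1 c2 ⊢
        generalize (intDoubleFactorial ((m : ℤ) + 2 - k - 1) : ℚ) = d1
        generalize (intDoubleFactorial ((m : ℤ) + 2 - k - 3) : ℚ) = d2
        linear_combination (k.factorial * d1 * d2 : ℚ) * ((m + 1) * (m.choose k : ℚ) * c1 +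
          ((m + 3).choose (k + 1)) * (k + 1) * c2)
      · simp

end QuadRec

theorem motzkinPoly_quadRec : QuadRec motzkinPoly :=
  ⟨motzkinPoly_zero, motzkinPoly_one, motzkinPoly_add_two⟩

/-! ### From words back to well-labelled paths -/

theorem count_zero_append_neg_one (e : List SignType) : (e ++ [-1]).count 0 = e.count 0 := by
  rw [List.count_append, List.count_cons_of_ne (by decide), List.count_nil, add_zero]

theorem factorial_mul_coeff_motzkinPoly (m k : ℕ) :
    ((m + 2).factorial : ℚ) * (motzkinPoly m).coeff k =
      ∑ e ∈ excursions m with e.count 0 = k, (compatCount (m + 2) (e ++ [-1]) : ℚ) := by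
  rw [motzkinPoly, finsetSum_coeff, mul_sum, sum_filter]
  refine sum_congr rfl fun e he => ?_
  obtain ⟨rfl, -⟩ := mem_excursions.1 he
  rw [wordWeight, coeff_C_mul_X_pow, count_zero_append_neg_one,
    List.length_append, List.length_singleton]
  simp only [eq_comm (a := k)]
  split_ifs
  · field_simp
  · simp

theorem height_eq_wordHeight {m : ℕ} (P : WellLabelledPath (m + 1)) (j : ℕ) :
    P.height j = wordHeight ((List.ofFn (n := m) P.step).take j) := by
  rw [wordHeight, List.map_take, List.map_ofFn, List.sum_take_ofFn]
  rfl

theorem count_ofFn {α : Type*} [DecidableEq α] {n : ℕ} (f : Fin n → α) (a : α) :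
    (List.ofFn f).count a = #{i | f i = a} := by
  induction n with
  | zero => simp
  | succ n ih =>
    rw [List.ofFn_succ, List.count_cons, ih, Fin.card_filter_univ_succ]
    simp only [beq_iff_eq]
    split_ifs <;> simp

theorem horizontalSteps_eq_count {m : ℕ} (P : WellLabelledPath (m + 1)) :
    P.horizontalSteps = (List.ofFn (n := m) P.step).count 0 := by
  exact (count_ofFn (n := m) P.step 0).symm

/-- The path is at a non-negative height before its last step and at `-1` after it, so that step is
a `-1` from height `0`. -/
theorem isMotzkin_iff {m : ℕ} (P : WellLabelledPath (m + 2)) :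
    P.IsMotzkin ↔ ∃ e ∈ excursions m, List.ofFn (n := m + 1) P.step = e ++ [-1] := by
  simp only [WellLabelledPath.IsMotzkin, height_eq_wordHeight]
  have hlen : (List.ofFn (n := m + 1) P.step).length = m + 1 := List.length_ofFn
  generalize List.ofFn (n := m + 1) P.step = w at hlen
  rw [Nat.add_sub_cancel_right (n := m + 1) (m := 1), List.take_of_length_le (by omega)]
  constructor
  · rintro ⟨h1, h2⟩
    have hm : 0 ≤ wordHeight (w.take m) := by
      rcases m with _ | m
      · simp
      · exact h1 _ (by omega) (by omega)
    have hs : w = w.take m ++ [w[m]] := by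
      rw [← List.take_succ_eq_append_getElem (by omega), List.take_of_length_le (by omega)]
    have h3 : w[m] = -1 ∧ wordHeight (w.take m) = 0 := by
      rw [hs, wordHeight_append] at h2
      generalize w[m] = s at h2
      rcases s with _ | _ | _ <;> simp at h2 ⊢ <;> omega
    refine ⟨w.take m, mem_excursions.2 ⟨by simp [hlen], h3.2, fun i => ?_⟩, h3.1 ▸ hs⟩
    rw [List.take_take]
    rcases Nat.eq_zero_or_pos (min i m) with h | h
    · simp [h]
    · exact h1 _ h (by omega)
  · rintro ⟨e, he, rfl⟩
    obtain ⟨rfl, he1, he2⟩ := mem_excursions.1 he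
    refine ⟨fun j _ hj => ?_, by simp [he1]⟩
    rw [List.take_append_of_le_length (by omega)]
    exact he2 j

theorem compat_ofFn_iff {m : ℕ} (s : Fin m → SignType) (σ : Equiv.Perm (Fin (m + 1))) :
    Compat (m + 1) (List.ofFn s) σ ↔
      ∀ i : Fin m, StepRel (s i) (σ i.castSucc) (σ i.succ) := by
  constructor
  · intro h i
    have := h i (by omega)
    rwa [List.getD_eq_getElem _ _ (by simp), List.getElem_ofFn] at this
  · intro h i hi
    rw [List.getD_eq_getElem _ _ (by simp; omega), List.getElem_ofFn]
    exact h ⟨i, by omega⟩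

theorem WellLabelledPath.compat {m : ℕ} (P : WellLabelledPath (m + 1)) :
    Compat (m + 1) (List.ofFn (n := m) P.step) P.label :=
  (compat_ofFn_iff (m := m) P.step P.label).2
    fun i => ⟨P.lt_of_step_eq_neg_one i, P.gt_of_step_eq_one i⟩

/-- The pairs of a word of a Motzkin path of size `m + 2`, without its last letter, and a
compatible permutation. -/
abbrev LabelledExcursion (m k : ℕ) : Type :=
  Σ e : {e ∈ excursions m | e.count 0 = k},
    {σ : Equiv.Perm (Fin (m + 2)) // Compat (m + 2) (e.1 ++ [-1]) σ}

theorem card_labelledExcursion (m k : ℕ) : Nat.card (LabelledExcursion m k) =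
    ∑ e ∈ excursions m with e.count 0 = k, compatCount (m + 2) (e ++ [-1]) := by
  classical
  rw [Nat.card_sigma, ← sum_coe_sort _ (fun e => compatCount (m + 2) (e ++ [-1]))]
  refine sum_congr rfl fun e _ => ?_
  rw [Nat.card_eq_fintype_card, Fintype.card_subtype, compatCount]

/-- The path given by a labelled excursion. -/
def LabelledExcursion.toPath {m k : ℕ} (x : LabelledExcursion m k) : WellLabelledPath (m + 2) where
  step := fun i : Fin (m + 1) => (x.1.1 ++ [-1]).getD i 0
  label := x.2.1
  lt_of_step_eq_neg_one i := (x.2.2 i (Nat.succ_lt_succ i.2)).1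
  gt_of_step_eq_one i := (x.2.2 i (Nat.succ_lt_succ i.2)).2

theorem LabelledExcursion.ofFn_step_toPath {m k : ℕ} (x : LabelledExcursion m k) :
    List.ofFn (n := m + 1) x.toPath.step = x.1.1 ++ [-1] := by
  have h := (mem_excursions.1 (mem_filter.1 x.1.2).1).1
  refine List.ext_getElem (by simp [h]) fun i hi hi' => ?_
  rw [List.getElem_ofFn]
  exact List.getD_eq_getElem _ _ hi'

theorem card_motzkin (m k : ℕ) :
    Nat.card {P : WellLabelledPath (m + 2) // P.IsMotzkin ∧ P.horizontalSteps = k} =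
      ∑ e ∈ excursions m with e.count 0 = k, compatCount (m + 2) (e ++ [-1]) := by
  rw [← card_labelledExcursion]
  symm
  refine Nat.card_eq_of_bijective (fun x => ⟨x.toPath, ?_, ?_⟩) ⟨fun x y h => ?_, fun P => ?_⟩
  · exact (isMotzkin_iff _).2 ⟨x.1.1, (mem_filter.1 x.1.2).1, x.ofFn_step_toPath⟩
  · rw [horizontalSteps_eq_count, x.ofFn_step_toPath, count_zero_append_neg_one]
    exact (mem_filter.1 x.1.2).2
  · have h' : x.toPath = y.toPath := congrArg Subtype.val h
    have h1 := congrArg (fun P => List.ofFn (n := m + 1) P.step) h'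
    have h2 : x.2.1 = y.2.1 := congrArg WellLabelledPath.label h'
    simp only [LabelledExcursion.ofFn_step_toPath, List.append_cancel_right_eq] at h1
    obtain ⟨⟨e, he⟩, σ, hσ⟩ := x
    obtain ⟨⟨e', he'⟩, σ', hσ'⟩ := y
    subst h1 h2
    rfl
  · obtain ⟨P, hP, hk⟩ := P
    obtain ⟨e, he, hs⟩ := (isMotzkin_iff P).1 hP
    rw [horizontalSteps_eq_count, hs, count_zero_append_neg_one] at hk
    refine ⟨⟨⟨e, mem_filter.2 ⟨he, hk⟩⟩, P.label, hs ▸ P.compat⟩, Subtype.ext ?_⟩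
    refine WellLabelledPath.ext ?_ rfl
    refine List.ofFn_injective (n := m + 1) ?_
    exact (LabelledExcursion.ofFn_step_toPath _).trans hs.symm

theorem mainTheorem5 (n k : ℕ) (hn : 1 ≤ n) :
    Nat.card {P : WellLabelledPath n // P.IsMotzkin ∧ P.horizontalSteps = k} =
      if Even ((n : ℤ) - k) then
        n.choose k * (n - 2).choose k * k.factorial *
          intDoubleFactorial ((n : ℤ) - k - 1) * intDoubleFactorial ((n : ℤ) - k - 3)
      else 0 := by
  obtain rfl | ⟨m, rfl⟩ : n = 1 ∨ ∃ m, n = m + 2 := by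
    rcases n with _ | _ | m
    · omega
    · exact Or.inl rfl
    · exact Or.inr ⟨m, rfl⟩
  -- The empty word ends at height `0`, not `-1`. The right-hand side vanishes too: by parity for `k
  -- = 0`, and for `k > 0` because `1 - 2` truncates to `0` in the second binomial.
  · have : IsEmpty {P : WellLabelledPath 1 // P.IsMotzkin ∧ P.horizontalSteps = k} := by
      refine ⟨fun ⟨P, hP, _⟩ => ?_⟩
      have := hP.2
      simp [height_eq_wordHeight] at this
    rw [Nat.card_of_isEmpty]
    rcases k with _ | k
    · simp
    · simp
  · have h := factorial_mul_coeff_motzkinPoly m k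
    rw [motzkinPoly_quadRec.factorial_mul_coeff] at h
    rw [card_motzkin]
    exact_mod_cast h.symm
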